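/- Let $\mathcal C$ be a $C^*$-algebra (not necessarily unital) and let $\mathcal D$ be a nonzero unital $C^*$-algebra. Let $\mathcal C\otimes^{\min}\mathcal D$ be the minimal tensor product, i.e. the completion of the algebraic tensor product $\mathcal C\otimes\mathcal D$ with respect to the norm $$\|z\|_{\min}=\sup\left\{\frac{(\varphi\otimes\psi)(w^*z^*zw)^{1/2}}{(\varphi\otimes\psi)(w^*w)^{1/2}} : \varphi,\psi \text{ states of } \mathcal C,\mathcal D,\ w\in\mathcal C\otimes\mathcal D,\ (\varphi\otimes\psi)(w^*w)\neq 0\right\},$$ where a state is a positive linear functional of norm one. For a $C^*$-subalgebra $\mathcal A\subseteq\mathcal C$, regard $\mathcal A\otimes^{\min}\mathcal D$ as the $C^*$-subalgebra of $\mathcal C\otimes^{\min}\mathcal D$ given by the norm closure of $\mathcal A\otimes\mathcal D$. For subalgebras $\mathcal S,\mathcal T$ of a normed algebra, with closed unit balls $B_1(\mathcal S),B_1(\mathcal T)$, let $d_{KK}(\mathcal S,\mathcal T)$ be the Hausdorff distance between $B_1(\mathcal S)$ and $B_1(\mathcal T)$. Write $\mathcal S\subseteq_\gamma\mathcal T$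 if for every $x\in B_1(\mathcal S)$ there is $y\in\mathcal T$ with $\|x-y\|\le\gamma$, and let $d_0(\mathcal S,\mathcal T)=\inf\{\gamma>0 : \mathcal S\subseteq_\gamma\mathcal T \text{ and } \mathcal T\subseteq_\gamma\mathcal S\}$. Then, for all $C^*$-subalgebras $\mathcal A,\mathcal B$ of $\mathcal C$, $$d_{KK}(\mathcal A,\mathcal B)\le d_{KK}(\mathcal A\otimes^{\min}\mathcal D,\ \mathcal B\otimes^{\min}\mathcal D)\quad\text{and}\quad d_0(\mathcal A,\mathcal B)\le d_0(\mathcal A\otimes^{\min}\mathcal D,\ \mathcal B\otimes^{\min}\mathcal D).$$ -/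

import Mathlib

open scoped TensorProduct

universe u v

/-! ### Distances between subspaces of a normed space -/

section Distances

variable {X : Type*} [SeminormedAddCommGroup X] [NormedSpace ℂ X]

/-- The closed unit ball of a subspace `S` of a normed space, as a subset of the ambient space. -/
def unitBall (S : Submodule ℂ X) : Set X := {x | x ∈ S ∧ ‖x‖ ≤ 1}

/-- The Kadison-Kastler distance: the Hausdorff distance between the closed unit balls. -/
noncomputable def dKK (S T : Submodule ℂ X) : ℝ :=
  Metric.hausdorffDist (unitBall S) (unitBall T)

/-- The near inclusion `S ⊆_γ T`: each `x` in the closed unit ball of `S` is within distance `γ`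
of some element of `T`. -/
def NearIncl (γ : ℝ) (S T : Submodule ℂ X) : Prop :=
  ∀ x ∈ unitBall S, ∃ y ∈ T, ‖x - y‖ ≤ γ

/-- The Christensen distance. -/
noncomputable def d0 (S T : Submodule ℂ X) : ℝ :=
  sInf {γ : ℝ | 0 < γ ∧ NearIncl γ S T ∧ NearIncl γ T S}

end Distances

/-! ### The minimal norm on the algebraic tensor product of two C⋆-algebras -/

noncomputable section MinNorm

open scoped ComplexOrder

/-- The state space of a C⋆-algebra: the positive linear functionals of norm one. -/
def stateSpace (C : Type*) [NonUnitalCStarAlgebra C] : Set (C →L[ℂ] ℂ) :=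
  {φ | (∀ a : C, 0 ≤ φ (star a * a)) ∧ ‖φ‖ = 1}

variable {C : Type u} {D : Type v} [NonUnitalCStarAlgebra C] [NonUnitalCStarAlgebra D]

/-- The functional `φ ⊗ ψ` on the algebraic tensor product, `c ⊗ d ↦ φ c * ψ d`. -/
def tensorFunctional (φ : C →L[ℂ] ℂ) (ψ : D →L[ℂ] ℂ) : C ⊗[ℂ] D →ₗ[ℂ] ℂ :=
  LinearMap.mul' ℂ ℂ ∘ₗ TensorProduct.map φ.toLinearMap ψ.toLinearMap

/-- The `C⋆`-minimal norm on the algebraic tensor product,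
`‖z‖ = sup ((φ ⊗ ψ)(w⋆ z⋆ z w))^{1/2} / ((φ ⊗ ψ)(w⋆ w))^{1/2}`, over all states `φ`, `ψ` and all
`w` with `(φ ⊗ ψ)(w⋆ w) ≠ 0`. -/
def minNorm (z : C ⊗[ℂ] D) : ℝ :=
  sSup {r : ℝ | ∃ φ ∈ stateSpace C, ∃ ψ ∈ stateSpace D, ∃ w : C ⊗[ℂ] D,
    tensorFunctional φ ψ (star w * w) ≠ 0 ∧
    r = √(tensorFunctional φ ψ (star w * star z * z * w)).re /
        √(tensorFunctional φ ψ (star w * w)).re}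

/-! The minimal norm is a C⋆-seminorm. -/

theorem exists_gns {φ : C →L[ℂ] ℂ} {ψ : D →L[ℂ] ℂ} (hφ : φ ∈ stateSpace C)
    (hψ : ψ ∈ stateSpace D) :
    ∃ (E : Type (max u v)) (_ : NormedAddCommGroup E) (_ : InnerProductSpace ℂ E) (V : C ⊗[ℂ] D →ₗ[ℂ] E),
      (∀ w w', inner ℂ (V w) (V w') = tensorFunctional φ ψ (star w * w')) ∧
      ∀ c d w, ‖V ((c ⊗ₜ d) * w)‖ ≤ ‖c‖ * ‖d‖ * ‖V w‖ := by
  let _ := CStarAlgebra.spectralOrder C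
  let _ := CStarAlgebra.spectralOrder D
  have _ := CStarAlgebra.spectralOrderedRing C
  have _ := CStarAlgebra.spectralOrderedRing D
  have pos1 : ∀ a b : C, a ≤ b → φ a ≤ φ b := by
    intro a b h
    obtain ⟨x, hx⟩ := CStarAlgebra.nonneg_iff_eq_star_mul_self.1 (sub_nonneg.2 h)
    rw [← sub_nonneg, ← map_sub, hx]; exact hφ.1 x
  have pos2 : ∀ a b : D, a ≤ b → ψ a ≤ ψ b := by
    intro a b h
    obtain ⟨x, hx⟩ := CStarAlgebra.nonneg_iff_eq_star_mul_self.1 (sub_nonneg.2 h)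
    rw [← sub_nonneg, ← map_sub, hx]; exact hψ.1 x
  let f : C →ₚ[ℂ] ℂ := { φ.toLinearMap with monotone' := fun a b h => pos1 a b h }
  let g : D →ₚ[ℂ] ℂ := { ψ.toLinearMap with monotone' := fun a b h => pos2 a b h }
  let Vf : C →ₗ[ℂ] f.GNS :=
    (UniformSpace.Completion.toComplₗᵢ (𝕜 := ℂ) (E := f.PreGNS)).toLinearMap ∘ₗ
      f.toPreGNS.toLinearMap
  let Vg : D →ₗ[ℂ] g.GNS :=
    (UniformSpace.Completion.toComplₗᵢ (𝕜 := ℂ) (E := g.PreGNS)).toLinearMap ∘ₗ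
      g.toPreGNS.toLinearMap
  have hVf : ∀ a b, inner ℂ (Vf a) (Vf b) = φ (star a * b) := fun a b => by
    simp only [Vf, LinearMap.comp_apply, LinearIsometry.coe_toLinearMap, LinearIsometry.inner_map_map]
    rfl
  have hVg : ∀ a b, inner ℂ (Vg a) (Vg b) = ψ (star a * b) := fun a b => by
    simp only [Vg, LinearMap.comp_apply, LinearIsometry.coe_toLinearMap, LinearIsometry.inner_map_map]
    rfl
  refine ⟨f.GNS ⊗[ℂ] g.GNS, inferInstance, inferInstance, TensorProduct.map Vf Vg, ?_, ?_⟩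
  · intro w w'
    induction w with
    | zero => simp
    | add x y hx hy => simp [add_mul, hx, hy]
    | tmul a b =>
      induction w' with
      | zero => simp
      | add x y hx hy => rw [map_add, inner_add_right, hx, hy, mul_add, map_add]
      | tmul a' b' => simp [hVf, hVg, tensorFunctional]
  · intro c d w
    have key : TensorProduct.map Vf Vg ((c ⊗ₜ d) * w) =
        TensorProduct.mapL (f.gnsNonUnitalStarAlgHom c) (g.gnsNonUnitalStarAlgHom d)
          (TensorProduct.map Vf Vg w) := by
      induction w with
      | zero => simp
      | add x y hx hy => rw [mul_add, map_add, map_add, map_add, hx, hy]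
      | tmul a b => simp [Vf, Vg]
    rw [key]
    refine (ContinuousLinearMap.le_opNorm _ _).trans ?_
    gcongr
    refine (TensorProduct.norm_mapL_le _ _).trans ?_
    gcongr
    · exact NonUnitalStarAlgHom.norm_apply_le _ _
    · exact NonUnitalStarAlgHom.norm_apply_le _ _

theorem exists_mul_bound (z : C ⊗[ℂ] D) :
    ∃ K : ℝ, 0 ≤ K ∧ ∀ (E : Type (max u v)) [NormedAddCommGroup E] [InnerProductSpace ℂ E]
      (V : C ⊗[ℂ] D →ₗ[ℂ] E), (∀ c d w, ‖V ((c ⊗ₜ d) * w)‖ ≤ ‖c‖ * ‖d‖ * ‖V w‖) →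
      ∀ w, ‖V (z * w)‖ ≤ K * ‖V w‖ := by
  induction z with
  | zero => exact ⟨0, le_rfl, fun E _ _ V _ w => by simp⟩
  | tmul c d => exact ⟨‖c‖ * ‖d‖, by positivity, fun E _ _ V h w => h c d w⟩
  | add x y hx hy =>
    obtain ⟨K, hK, h1⟩ := hx
    obtain ⟨L, hL, h2⟩ := hy
    refine ⟨K + L, by positivity, fun E _ _ V h w => ?_⟩
    rw [add_mul, map_add, add_mul]
    exact (norm_add_le _ _).trans (add_le_add (h1 E V h w) (h2 E V h w))

/-- The square root of `(φ ⊗ ψ)(w⋆ w)`. -/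
def stateNorm (φ : C →L[ℂ] ℂ) (ψ : D →L[ℂ] ℂ) (w : C ⊗[ℂ] D) : ℝ :=
  √(tensorFunctional φ ψ (star w * w)).re

theorem stateNorm_nonneg (φ : C →L[ℂ] ℂ) (ψ : D →L[ℂ] ℂ) (w : C ⊗[ℂ] D) :
    0 ≤ stateNorm φ ψ w := Real.sqrt_nonneg _

theorem stateNorm_eq {E : Type*} [NormedAddCommGroup E] [InnerProductSpace ℂ E]
    {φ : C →L[ℂ] ℂ} {ψ : D →L[ℂ] ℂ} (V : C ⊗[ℂ] D →ₗ[ℂ] E)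
    (h : ∀ w w', inner ℂ (V w) (V w') = tensorFunctional φ ψ (star w * w')) (w : C ⊗[ℂ] D) :
    stateNorm φ ψ w = ‖V w‖ := by
  rw [stateNorm, ← h, norm_eq_sqrt_re_inner (𝕜 := ℂ)]; rfl

theorem stateNorm_add_le {φ : C →L[ℂ] ℂ} {ψ : D →L[ℂ] ℂ} (hφ : φ ∈ stateSpace C)
    (hψ : ψ ∈ stateSpace D) (w w' : C ⊗[ℂ] D) :
    stateNorm φ ψ (w + w') ≤ stateNorm φ ψ w + stateNorm φ ψ w' := by
  obtain ⟨E, _, _, V, hV, -⟩ := exists_gns hφ hψ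
  simp only [stateNorm_eq V hV, map_add]
  exact norm_add_le _ _

theorem stateNorm_smul {φ : C →L[ℂ] ℂ} {ψ : D →L[ℂ] ℂ} (hφ : φ ∈ stateSpace C)
    (hψ : ψ ∈ stateSpace D) (a : ℂ) (w : C ⊗[ℂ] D) :
    stateNorm φ ψ (a • w) = ‖a‖ * stateNorm φ ψ w := by
  obtain ⟨E, _, _, V, hV, -⟩ := exists_gns hφ hψ
  simp only [stateNorm_eq V hV, map_smul, norm_smul]

theorem stateNorm_ne_zero_iff {φ : C →L[ℂ] ℂ} {ψ : D →L[ℂ] ℂ} (hφ : φ ∈ stateSpace C)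
    (hψ : ψ ∈ stateSpace D) (w : C ⊗[ℂ] D) :
    tensorFunctional φ ψ (star w * w) ≠ 0 ↔ stateNorm φ ψ w ≠ 0 := by
  obtain ⟨E, _, _, V, hV, -⟩ := exists_gns hφ hψ
  rw [stateNorm_eq V hV, ← hV, inner_self_ne_zero, norm_ne_zero_iff]

theorem norm_tensorFunctional_le {φ : C →L[ℂ] ℂ} {ψ : D →L[ℂ] ℂ} (hφ : φ ∈ stateSpace C)
    (hψ : ψ ∈ stateSpace D) (w w' : C ⊗[ℂ] D) :
    ‖tensorFunctional φ ψ (star w * w')‖ ≤ stateNorm φ ψ w * stateNorm φ ψ w' := by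
  obtain ⟨E, _, _, V, hV, -⟩ := exists_gns hφ hψ
  rw [stateNorm_eq V hV, stateNorm_eq V hV, ← hV]
  exact norm_inner_le_norm _ _

theorem stateNorm_sq {φ : C →L[ℂ] ℂ} {ψ : D →L[ℂ] ℂ} (hφ : φ ∈ stateSpace C)
    (hψ : ψ ∈ stateSpace D) (w : C ⊗[ℂ] D) :
    stateNorm φ ψ w ^ 2 = ‖tensorFunctional φ ψ (star w * w)‖ := by
  obtain ⟨E, _, _, V, hV, -⟩ := exists_gns hφ hψ
  rw [stateNorm_eq V hV, ← hV, inner_self_eq_norm_sq_to_K]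
  simp

theorem minNorm_eq (z : C ⊗[ℂ] D) : minNorm z =
    sSup {r : ℝ | ∃ φ ∈ stateSpace C, ∃ ψ ∈ stateSpace D, ∃ w : C ⊗[ℂ] D,
      tensorFunctional φ ψ (star w * w) ≠ 0 ∧
      r = stateNorm φ ψ (z * w) / stateNorm φ ψ w} := by
  simp only [minNorm, stateNorm, star_mul, mul_assoc]

theorem minNorm_nonneg (z : C ⊗[ℂ] D) : 0 ≤ minNorm z := by
  rw [minNorm_eq]
  apply Real.sSup_nonneg
  rintro _ ⟨φ, -, ψ, -, w, -, rfl⟩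
  exact div_nonneg (stateNorm_nonneg _ _ _) (stateNorm_nonneg _ _ _)

theorem stateNorm_mul_le {φ : C →L[ℂ] ℂ} {ψ : D →L[ℂ] ℂ} (hφ : φ ∈ stateSpace C)
    (hψ : ψ ∈ stateSpace D) (z w : C ⊗[ℂ] D) :
    stateNorm φ ψ (z * w) ≤ minNorm z * stateNorm φ ψ w := by
  obtain ⟨K, hK, hb⟩ := exists_mul_bound z
  have hb' : ∀ φ ∈ stateSpace C, ∀ ψ ∈ stateSpace D, ∀ w,
      stateNorm φ ψ (z * w) ≤ K * stateNorm φ ψ w := by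
    intro φ hφ ψ hψ w
    obtain ⟨E, _, _, V, hV, h⟩ := exists_gns hφ hψ
    rw [stateNorm_eq V hV, stateNorm_eq V hV]
    exact hb E V h w
  by_cases hw : stateNorm φ ψ w = 0
  · have := hb' φ hφ ψ hψ w
    rw [hw, mul_zero] at this ⊢
    exact this
  · have hpos : 0 < stateNorm φ ψ w := (stateNorm_nonneg _ _ _).lt_of_ne' hw
    rw [← div_le_iff₀ hpos, minNorm_eq]
    apply le_csSup
    · refine ⟨K, ?_⟩
      rintro _ ⟨φ, hφ, ψ, hψ, w, hw, rfl⟩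
      exact div_le_of_le_mul₀ (stateNorm_nonneg _ _ _) hK (hb' φ hφ ψ hψ w)
    · exact ⟨φ, hφ, ψ, hψ, w, (stateNorm_ne_zero_iff hφ hψ w).2 hw, rfl⟩

theorem minNorm_le {z : C ⊗[ℂ] D} {M : ℝ} (hM : 0 ≤ M)
    (h : ∀ φ ∈ stateSpace C, ∀ ψ ∈ stateSpace D, ∀ w,
      stateNorm φ ψ (z * w) ≤ M * stateNorm φ ψ w) : minNorm z ≤ M := by
  rw [minNorm_eq]
  apply Real.sSup_le _ hM
  rintro _ ⟨φ, hφ, ψ, hψ, w, -, rfl⟩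
  exact div_le_of_le_mul₀ (stateNorm_nonneg _ _ _) hM (h φ hφ ψ hψ w)

theorem minNorm_add_le (z z' : C ⊗[ℂ] D) : minNorm (z + z') ≤ minNorm z + minNorm z' := by
  refine minNorm_le (add_nonneg (minNorm_nonneg _) (minNorm_nonneg _)) fun φ hφ ψ hψ w => ?_
  rw [add_mul, add_mul]
  exact (stateNorm_add_le hφ hψ _ _).trans
    (add_le_add (stateNorm_mul_le hφ hψ _ _) (stateNorm_mul_le hφ hψ _ _))

theorem minNorm_smul_le (a : ℂ) (z : C ⊗[ℂ] D) : minNorm (a • z) ≤ ‖a‖ * minNorm z := by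
  refine minNorm_le (mul_nonneg (norm_nonneg _) (minNorm_nonneg _)) fun φ hφ ψ hψ w => ?_
  rw [smul_mul_assoc, stateNorm_smul hφ hψ, mul_assoc]
  exact mul_le_mul_of_nonneg_left (stateNorm_mul_le hφ hψ _ _) (norm_nonneg _)

theorem minNorm_zero : minNorm (0 : C ⊗[ℂ] D) = 0 := by
  have := minNorm_smul_le (0 : ℂ) (0 : C ⊗[ℂ] D)
  rw [smul_zero, norm_zero, zero_mul] at this
  exact le_antisymm this (minNorm_nonneg _)

theorem minNorm_neg (z : C ⊗[ℂ] D) : minNorm (-z) = minNorm z := by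
  have key : ∀ z : C ⊗[ℂ] D, minNorm (-z) ≤ minNorm z := fun z => by
    have := minNorm_smul_le (-1 : ℂ) z
    rwa [neg_smul, one_smul, norm_neg, norm_one, one_mul] at this
  exact le_antisymm (key z) (by simpa only [neg_neg] using key (-z))

theorem minNorm_mul_le (z z' : C ⊗[ℂ] D) : minNorm (z * z') ≤ minNorm z * minNorm z' := by
  refine minNorm_le (mul_nonneg (minNorm_nonneg _) (minNorm_nonneg _)) fun φ hφ ψ hψ w => ?_
  rw [mul_assoc, mul_assoc]
  exact (stateNorm_mul_le hφ hψ _ _).trans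
    (mul_le_mul_of_nonneg_left (stateNorm_mul_le hφ hψ _ _) (minNorm_nonneg _))

theorem minNorm_star_le (z : C ⊗[ℂ] D) : minNorm (star z) ≤ minNorm z := by
  refine minNorm_le (minNorm_nonneg _) fun φ hφ ψ hψ w => ?_
  have h1 : stateNorm φ ψ (star z * w) ^ 2 ≤
      stateNorm φ ψ w * (minNorm z * stateNorm φ ψ (star z * w)) := by
    rw [stateNorm_sq hφ hψ, star_mul, star_star, mul_assoc]
    exact (norm_tensorFunctional_le hφ hψ _ _).trans
      (mul_le_mul_of_nonneg_left (stateNorm_mul_le hφ hψ _ _) (stateNorm_nonneg _ _ _))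
  have := stateNorm_nonneg φ ψ (star z * w)
  rcases this.eq_or_lt with h | h
  · rw [← h]; exact mul_nonneg (minNorm_nonneg _) (stateNorm_nonneg _ _ _)
  · nlinarith

theorem minNorm_star (z : C ⊗[ℂ] D) : minNorm (star z) = minNorm z :=
  le_antisymm (minNorm_star_le z) (by simpa using minNorm_star_le (star z))

theorem minNorm_sq_le (z : C ⊗[ℂ] D) : minNorm z * minNorm z ≤ minNorm (star z * z) := by
  have : minNorm z ≤ √(minNorm (star z * z)) := by
    refine minNorm_le (Real.sqrt_nonneg _) fun φ hφ ψ hψ w => ?_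
    refine abs_le_of_sq_le_sq' ?_ (mul_nonneg (Real.sqrt_nonneg _) (stateNorm_nonneg _ _ _)) |>.2
    rw [mul_pow, Real.sq_sqrt (minNorm_nonneg _), stateNorm_sq hφ hψ, star_mul, mul_assoc,
      ← mul_assoc (star z)]
    refine (norm_tensorFunctional_le hφ hψ _ _).trans ?_
    have := mul_le_mul_of_nonneg_left (stateNorm_mul_le hφ hψ (star z * z) w)
      (stateNorm_nonneg φ ψ w)
    linarith
  rw [← pow_two, ← Real.sq_sqrt (minNorm_nonneg (star z * z))]
  exact pow_le_pow_left₀ (minNorm_nonneg _) this 2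

end MinNorm

/-! ### The minimal tensor product -/

noncomputable section MinTensorProduct

/-- The algebraic tensor product of two C⋆-algebras, as a type synonym that carries the
minimal norm. -/
def AlgTensor (C : Type u) (D : Type v) [NonUnitalCStarAlgebra C] [NonUnitalCStarAlgebra D] :
    Type (max u v) := C ⊗[ℂ] D

variable (C : Type u) (D : Type v) [NonUnitalCStarAlgebra C] [NonUnitalCStarAlgebra D]

namespace AlgTensor

instance : NonUnitalRing (AlgTensor C D) := inferInstanceAs (NonUnitalRing (C ⊗[ℂ] D))
instance : Module ℂ (AlgTensor C D) := inferInstanceAs (Module ℂ (C ⊗[ℂ] D))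
instance : StarRing (AlgTensor C D) := inferInstanceAs (StarRing (C ⊗[ℂ] D))
instance : StarModule ℂ (AlgTensor C D) := inferInstanceAs (StarModule ℂ (C ⊗[ℂ] D))
instance : IsScalarTower ℂ (AlgTensor C D) (AlgTensor C D) :=
  inferInstanceAs (IsScalarTower ℂ (C ⊗[ℂ] D) (C ⊗[ℂ] D))
instance : SMulCommClass ℂ (AlgTensor C D) (AlgTensor C D) :=
  inferInstanceAs (SMulCommClass ℂ (C ⊗[ℂ] D) (C ⊗[ℂ] D))

instance : Norm (AlgTensor C D) := ⟨fun z => minNorm (C := C) (D := D) z⟩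

/-- The elementary tensor `c ⊗ d`. -/
def tmul {C : Type u} {D : Type v} [NonUnitalCStarAlgebra C] [NonUnitalCStarAlgebra D]
    (c : C) (d : D) : AlgTensor C D := c ⊗ₜ[ℂ] d

instance : SeminormedAddCommGroup (AlgTensor C D) :=
  AddGroupSeminorm.toSeminormedAddCommGroup
    { toFun := fun z => minNorm (C := C) (D := D) z
      map_zero' := minNorm_zero
      add_le' := minNorm_add_le
      neg' := minNorm_neg }

theorem norm_def (z : AlgTensor C D) : ‖z‖ = minNorm (C := C) (D := D) z := rfl

instance : NonUnitalSeminormedRing (AlgTensor C D) where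
  __ := (inferInstance : SeminormedAddCommGroup (AlgTensor C D))
  __ := (inferInstance : NonUnitalRing (AlgTensor C D))
  norm_mul_le := minNorm_mul_le (C := C) (D := D)

instance : NormedSpace ℂ (AlgTensor C D) where
  norm_smul_le := minNorm_smul_le (C := C) (D := D)

instance : NormedStarGroup (AlgTensor C D) where
  norm_star_le := minNorm_star_le (C := C) (D := D)

theorem tmul_mul_tmul {C : Type u} {D : Type v} [NonUnitalCStarAlgebra C] [NonUnitalCStarAlgebra D]
    (a b : C) (d e : D) : tmul a d * tmul b e = tmul (a * b) (d * e) :=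
  Algebra.TensorProduct.tmul_mul_tmul (R := ℂ) a b d e

theorem star_tmul {C : Type u} {D : Type v} [NonUnitalCStarAlgebra C] [NonUnitalCStarAlgebra D]
    (a : C) (d : D) : star (tmul a d) = tmul (star a) (star d) :=
  TensorProduct.star_tmul (R := ℂ) a d

end AlgTensor

/-- The minimal tensor product of two C⋆-algebras: the completion of their algebraic tensor product
with respect to the minimal norm. -/
def MinTensor : Type (max u v) := UniformSpace.Completion (AlgTensor C D)

namespace MinTensor

open UniformSpace

instance : NormedAddCommGroup (MinTensor C D) :=
  inferInstanceAs (NormedAddCommGroup (Completion (AlgTensor C D)))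
instance : NormedSpace ℂ (MinTensor C D) :=
  inferInstanceAs (NormedSpace ℂ (Completion (AlgTensor C D)))
instance : CompleteSpace (MinTensor C D) :=
  inferInstanceAs (CompleteSpace (Completion (AlgTensor C D)))

/-- The canonical map of the algebraic tensor product into its completion. -/
def ofAlg : AlgTensor C D →ₗᵢ[ℂ] MinTensor C D := Completion.toComplₗᵢ

theorem isDenseInducing_ofAlg : IsDenseInducing (ofAlg C D) := Completion.isDenseInducing_coe

theorem denseRange_ofAlg : DenseRange (ofAlg C D) := (isDenseInducing_ofAlg C D).dense

/-- Multiplication and involution are the continuous extensions of those of the algebraic tensor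
product. -/
instance : Mul (MinTensor C D) where
  mul x y := ((isDenseInducing_ofAlg C D).prodMap (isDenseInducing_ofAlg C D)).extend
    (fun p : AlgTensor C D × AlgTensor C D => ofAlg C D (p.1 * p.2)) (x, y)

instance : Star (MinTensor C D) where
  star := Completion.map (star : AlgTensor C D → AlgTensor C D)

theorem ofAlg_mul (x y : AlgTensor C D) : ofAlg C D (x * y) = ofAlg C D x * ofAlg C D y :=
  (((isDenseInducing_ofAlg C D).prodMap (isDenseInducing_ofAlg C D)).extend_eq
    ((ofAlg C D).continuous.comp continuous_mul) (x, y)).symm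

theorem ofAlg_star (x : AlgTensor C D) : ofAlg C D (star x) = star (ofAlg C D x) :=
  (Completion.map_coe (starₗᵢ ℂ : AlgTensor C D ≃ₗᵢ⋆[ℂ] AlgTensor C D).isometry.uniformContinuous
    x).symm

instance : ContinuousMul (MinTensor C D) where
  continuous_mul := by
    let m := (AddMonoidHom.mul : AlgTensor C D →+ AlgTensor C D →+ AlgTensor C D).compr₂
      (ofAlg C D).toLinearMap.toAddMonoidHom
    have hm : Continuous fun p : AlgTensor C D × AlgTensor C D => m p.1 p.2 :=
      (ofAlg C D).continuous.comp continuous_mul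
    have di : IsDenseInducing ((ofAlg C D).toLinearMap.toAddMonoidHom) :=
      isDenseInducing_ofAlg C D
    exact (di.extend_Z_bilin di hm :)

instance : ContinuousStar (MinTensor C D) where
  continuous_star := Completion.continuous_map

variable {C D}

@[elab_as_elim]
theorem ind {p : MinTensor C D → Prop} (x : MinTensor C D) (hp : IsClosed {x | p x})
    (h : ∀ z, p (ofAlg C D z)) : p x := Completion.induction_on x hp h

@[elab_as_elim]
theorem ind₂ {p : MinTensor C D → MinTensor C D → Prop} (x y : MinTensor C D)
    (hp : IsClosed {q : MinTensor C D × MinTensor C D | p q.1 q.2})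
    (h : ∀ z w, p (ofAlg C D z) (ofAlg C D w)) : p x y := Completion.induction_on₂ x y hp h

@[elab_as_elim]
theorem ind₃ {p : MinTensor C D → MinTensor C D → MinTensor C D → Prop} (x y z : MinTensor C D)
    (hp : IsClosed {q : MinTensor C D × MinTensor C D × MinTensor C D | p q.1 q.2.1 q.2.2})
    (h : ∀ a b c, p (ofAlg C D a) (ofAlg C D b) (ofAlg C D c)) : p x y z :=
  Completion.induction_on₃ x y z hp h

variable (C D)

instance : NonUnitalNormedRing (MinTensor C D) where
  __ := (inferInstance : NormedAddCommGroup (MinTensor C D))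
  zero_mul a := ind a (isClosed_eq (by fun_prop) (by fun_prop))
    fun a => by rw [← map_zero (ofAlg C D), ← ofAlg_mul, zero_mul]
  mul_zero a := ind a (isClosed_eq (by fun_prop) (by fun_prop))
    fun a => by rw [← map_zero (ofAlg C D), ← ofAlg_mul, mul_zero]
  mul_assoc a b c := ind₃ a b c (isClosed_eq (by fun_prop) (by fun_prop))
    fun a b c => by simp only [← ofAlg_mul, mul_assoc]
  left_distrib a b c := ind₃ a b c (isClosed_eq (by fun_prop) (by fun_prop))
    fun a b c => by simp only [← ofAlg_mul, ← map_add, mul_add]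
  right_distrib a b c := ind₃ a b c (isClosed_eq (by fun_prop) (by fun_prop))
    fun a b c => by simp only [← ofAlg_mul, ← map_add, add_mul]
  norm_mul_le a b := ind₂ a b (isClosed_le (by fun_prop) (by fun_prop))
    fun a b => by simpa only [← ofAlg_mul, LinearIsometry.norm_map] using norm_mul_le a b

instance : StarRing (MinTensor C D) where
  star_involutive a := ind a (isClosed_eq (by fun_prop) (by fun_prop))
    fun a => by rw [← ofAlg_star, ← ofAlg_star, star_star]
  star_mul a b := ind₂ a b (isClosed_eq (by fun_prop) (by fun_prop))
    fun a b => by simp only [← ofAlg_mul, ← ofAlg_star, star_mul]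
  star_add a b := ind₂ a b (isClosed_eq (by fun_prop) (by fun_prop))
    fun a b => by simp only [← map_add, ← ofAlg_star, star_add]

instance : CStarRing (MinTensor C D) where
  norm_mul_self_le a := ind a (isClosed_le (by fun_prop) (by fun_prop))
    fun a => by
      rw [← ofAlg_star, ← ofAlg_mul, LinearIsometry.norm_map, LinearIsometry.norm_map]
      exact minNorm_sq_le (C := C) (D := D) a

instance : IsScalarTower ℂ (MinTensor C D) (MinTensor C D) where
  smul_assoc r a b := ind₂ a b
    (isClosed_eq ((continuous_fst.const_smul r).mul continuous_snd)
      ((continuous_fst.mul continuous_snd).const_smul r))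
    fun a b => by
      simp only [smul_eq_mul]
      rw [← map_smul, ← ofAlg_mul, ← ofAlg_mul, ← map_smul, smul_mul_assoc]

instance : SMulCommClass ℂ (MinTensor C D) (MinTensor C D) where
  smul_comm r a b := ind₂ a b
    (isClosed_eq ((continuous_fst.mul continuous_snd).const_smul r)
      (continuous_fst.mul (continuous_snd.const_smul r)))
    fun a b => by
      simp only [smul_eq_mul]
      rw [← map_smul, ← ofAlg_mul, ← ofAlg_mul, ← map_smul, mul_smul_comm]

instance : StarModule ℂ (MinTensor C D) where
  star_smul r a := ind a
    (isClosed_eq (continuous_id.const_smul r).star (continuous_star.const_smul (star r)))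
    fun a => by rw [← map_smul, ← ofAlg_star, ← ofAlg_star, ← map_smul, star_smul]

/-- The minimal tensor product is a C⋆-algebra. -/
instance : NonUnitalCStarAlgebra (MinTensor C D) where

/-- The canonical embedding of the algebraic tensor product as a `⋆`-homomorphism. -/
def ofAlgHom : AlgTensor C D →⋆ₙₐ[ℂ] MinTensor C D where
  toFun := ofAlg C D
  map_smul' := map_smul (ofAlg C D)
  map_zero' := map_zero (ofAlg C D)
  map_add' := map_add (ofAlg C D)
  map_mul' := ofAlg_mul C D
  map_star' := ofAlg_star C D

end MinTensor

variable {C}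

/-- The algebraic tensor product `A ⊗ D`, as a subspace of `C ⊗ D`: the linear span of the
elementary tensors `a ⊗ d` with `a ∈ A`. -/
def algTensorSpan (A : NonUnitalStarSubalgebra ℂ C) : Submodule ℂ (AlgTensor C D) :=
  Submodule.span ℂ {z | ∃ a ∈ A, ∃ d : D, z = AlgTensor.tmul a d}

variable {D}

theorem mul_mem_algTensorSpan {A : NonUnitalStarSubalgebra ℂ C} {x y : AlgTensor C D}
    (hx : x ∈ algTensorSpan D A) (hy : y ∈ algTensorSpan D A) : x * y ∈ algTensorSpan D A := by
  unfold algTensorSpan at hx hy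
  induction hx, hy using Submodule.span_induction₂ with
  | mem_mem x y hx hy =>
    obtain ⟨a, ha, d, rfl⟩ := hx
    obtain ⟨b, hb, e, rfl⟩ := hy
    rw [AlgTensor.tmul_mul_tmul]
    exact Submodule.subset_span ⟨a * b, mul_mem ha hb, d * e, rfl⟩
  | zero_left y hy => rw [zero_mul]; exact Submodule.zero_mem _
  | zero_right x hx => rw [mul_zero]; exact Submodule.zero_mem _
  | add_left x y z _ _ _ h1 h2 => rw [add_mul]; exact Submodule.add_mem _ h1 h2
  | add_right x y z _ _ _ h1 h2 => rw [mul_add]; exact Submodule.add_mem _ h1 h2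
  | smul_left r x y _ _ h => rw [smul_mul_assoc]; exact Submodule.smul_mem _ r h
  | smul_right r x y _ _ h => rw [mul_smul_comm]; exact Submodule.smul_mem _ r h

theorem star_mem_algTensorSpan {A : NonUnitalStarSubalgebra ℂ C} {x : AlgTensor C D}
    (hx : x ∈ algTensorSpan D A) : star x ∈ algTensorSpan D A := by
  unfold algTensorSpan at hx
  induction hx using Submodule.span_induction with
  | mem x hx =>
    obtain ⟨a, ha, d, rfl⟩ := hx
    rw [AlgTensor.star_tmul]
    exact Submodule.subset_span ⟨star a, star_mem ha, star d, rfl⟩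
  | zero => rw [star_zero]; exact Submodule.zero_mem _
  | add x y _ _ h1 h2 => rw [star_add]; exact Submodule.add_mem _ h1 h2
  | smul r x _ h => rw [star_smul]; exact Submodule.smul_mem _ _ h

variable (D)

/-- The algebraic tensor product `A ⊗ D`, as a `⋆`-subalgebra of `C ⊗ D`. -/
def algTensorSub (A : NonUnitalStarSubalgebra ℂ C) : NonUnitalStarSubalgebra ℂ (AlgTensor C D) where
  carrier := algTensorSpan D A
  zero_mem' := (algTensorSpan D A).zero_mem
  add_mem' := (algTensorSpan D A).add_mem
  smul_mem' r _ h := (algTensorSpan D A).smul_mem r h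
  mul_mem' := mul_mem_algTensorSpan
  star_mem' := star_mem_algTensorSpan

/-- `A ⊗ᵐⁱⁿ D` as a C⋆-subalgebra of `C ⊗ᵐⁱⁿ D`: the norm closure of the algebraic tensor
product `A ⊗ D`. -/
def minTensorSub (A : NonUnitalStarSubalgebra ℂ C) : NonUnitalStarSubalgebra ℂ (MinTensor C D) :=
  ((algTensorSub D A).map (MinTensor.ofAlgHom C D)).topologicalClosure

end MinTensorProduct

/-! ### Contractive retractions and distances between subspaces -/

section Distances

variable {X Y : Type*} [SeminormedAddCommGroup X] [NormedSpace ℂ X]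
  [SeminormedAddCommGroup Y] [NormedSpace ℂ Y]

/-! A state `ψ` of `D` with `ψ 1 = 1` makes `C` a contractive retract of `C ⊗ᵐⁱⁿ D`: the
amplification `c ↦ c ⊗ 1` is a contraction, and the slice map `c ⊗ d ↦ ψ d • c` is a contractive
left inverse of it. Amplification carries `A` into `A ⊗ᵐⁱⁿ D`, and slicing carries `A ⊗ᵐⁱⁿ D` back
into `A` because `A` is closed; likewise for `B`. An approximation of `x ⊗ 1` in `B ⊗ᵐⁱⁿ D` is
therefore sliced to an approximation of `x` in `B` that is at least as good, and neither distance
can grow (`dKK_le_of_retract`, `d0_le_of_retract`).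

The analytic content is `norm_sliceMap_le`, the contractivity of the slice map for the minimal norm.
It compares coefficients of the slice in a state `φ` of `C` with coefficients of `z` in `φ ⊗ ψ` and
applies Cauchy–Schwarz. It needs states that norm a given element, and these come from Hahn–Banach
in the unitization (`exists_state_apply_star_mul_self`). -/

theorem map_mem_unitBall {f : X →ₗ[ℂ] Y} (hf : ∀ x, ‖f x‖ ≤ ‖x‖) {S : Submodule ℂ X}
    {S' : Submodule ℂ Y} (h : ∀ x ∈ S, f x ∈ S') {x : X} (hx : x ∈ unitBall S) :
    f x ∈ unitBall S' :=
  ⟨h x hx.1, (hf x).trans hx.2⟩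

theorem zero_mem_unitBall (S : Submodule ℂ X) : (0 : X) ∈ unitBall S :=
  ⟨S.zero_mem, by simp⟩

theorem isBounded_unitBall (S : Submodule ℂ X) : Bornology.IsBounded (unitBall S) :=
  isBounded_iff_forall_norm_le.2 ⟨1, fun _ hx => hx.2⟩

theorem infDist_unitBall_le_dKK {S T : Submodule ℂ X} {x : X} (hx : x ∈ unitBall S) :
    Metric.infDist x (unitBall T) ≤ dKK S T :=
  Metric.infDist_le_hausdorffDist_of_mem hx <|
    -- Finiteness matters: an infinite extended distance would become the real number 0.
    Metric.hausdorffEDist_ne_top_of_nonempty_of_bounded ⟨0, zero_mem_unitBall S⟩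
      ⟨0, zero_mem_unitBall T⟩ (isBounded_unitBall S) (isBounded_unitBall T)

/-- For `y` in the larger unit ball, `r y` is an admissible competitor, and `x - r y = r (i x - y)`
is no longer than `i x - y`. -/
theorem infDist_unitBall_le_of_retract {i : X →ₗ[ℂ] Y} {r : Y →ₗ[ℂ] X}
    (hi : ∀ x, ‖i x‖ ≤ ‖x‖) (hr : ∀ y, ‖r y‖ ≤ ‖y‖) (hri : ∀ x, r (i x) = x)
    {S T : Submodule ℂ X} {S' T' : Submodule ℂ Y}
    (hS : ∀ x ∈ S, i x ∈ S') (hT : ∀ y ∈ T', r y ∈ T) {x : X} (hx : x ∈ unitBall S) :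
    Metric.infDist x (unitBall T) ≤ dKK S' T' := by
  refine le_trans ?_ (infDist_unitBall_le_dKK (map_mem_unitBall hi hS hx))
  refine (Metric.le_infDist ⟨0, zero_mem_unitBall T'⟩).2 fun y hy => ?_
  refine (Metric.infDist_le_dist_of_mem (map_mem_unitBall hr hT hy)).trans ?_
  calc dist x (r y) = ‖r (i x - y)‖ := by rw [dist_eq_norm, map_sub, hri]
    _ ≤ dist (i x) y := by rw [dist_eq_norm]; exact hr _

theorem NearIncl.of_retract {i : X →ₗ[ℂ] Y} {r : Y →ₗ[ℂ] X}
    (hi : ∀ x, ‖i x‖ ≤ ‖x‖) (hr : ∀ y, ‖r y‖ ≤ ‖y‖) (hri : ∀ x, r (i x) = x)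
    {S T : Submodule ℂ X} {S' T' : Submodule ℂ Y}
    (hS : ∀ x ∈ S, i x ∈ S') (hT : ∀ y ∈ T', r y ∈ T) {γ : ℝ} (h : NearIncl γ S' T') :
    NearIncl γ S T := by
  intro x hx
  obtain ⟨y, hy, hxy⟩ := h _ (map_mem_unitBall hi hS hx)
  refine ⟨r y, hT y hy, ?_⟩
  calc ‖x - r y‖ = ‖r (i x - y)‖ := by rw [map_sub, hri]
    _ ≤ γ := (hr _).trans hxy

theorem dKK_le_of_retract {i : X →ₗ[ℂ] Y} {r : Y →ₗ[ℂ] X}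
    (hi : ∀ x, ‖i x‖ ≤ ‖x‖) (hr : ∀ y, ‖r y‖ ≤ ‖y‖) (hri : ∀ x, r (i x) = x)
    {S T : Submodule ℂ X} {S' T' : Submodule ℂ Y}
    (hS : ∀ x ∈ S, i x ∈ S') (hT : ∀ x ∈ T, i x ∈ T')
    (hS' : ∀ y ∈ S', r y ∈ S) (hT' : ∀ y ∈ T', r y ∈ T) : dKK S T ≤ dKK S' T' := by
  refine Metric.hausdorffDist_le_of_infDist Metric.hausdorffDist_nonneg
    (fun x hx => infDist_unitBall_le_of_retract hi hr hri hS hT' hx) fun x hx => ?_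
  have := infDist_unitBall_le_of_retract hi hr hri hT hS' hx
  rwa [dKK, Metric.hausdorffDist_comm] at this

theorem d0_le_of_retract {i : X →ₗ[ℂ] Y} {r : Y →ₗ[ℂ] X}
    (hi : ∀ x, ‖i x‖ ≤ ‖x‖) (hr : ∀ y, ‖r y‖ ≤ ‖y‖) (hri : ∀ x, r (i x) = x)
    {S T : Submodule ℂ X} {S' T' : Submodule ℂ Y}
    (hS : ∀ x ∈ S, i x ∈ S') (hT : ∀ x ∈ T, i x ∈ T')
    (hS' : ∀ y ∈ S', r y ∈ S) (hT' : ∀ y ∈ T', r y ∈ T) : d0 S T ≤ d0 S' T' := by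
  refine csInf_le_csInf ⟨0, fun γ hγ => hγ.1.le⟩ ?_ fun γ hγ =>
    ⟨hγ.1, hγ.2.1.of_retract hi hr hri hS hT', hγ.2.2.of_retract hi hr hri hT hS'⟩
  -- The set on the right must be nonempty, since `sInf ∅ = 0`. The value `γ = 1` always belongs to
  -- it, with 0 as the approximant.
  exact ⟨1, one_pos, fun x hx => ⟨0, zero_mem _, by simpa using hx.2⟩,
    fun x hx => ⟨0, zero_mem _, by simpa using hx.2⟩⟩

end Distances

open scoped ComplexOrder

/-! ### Existence of norming states -/

section States

/-- Write `h` for `star a * a`. Testing `f` on `h + it` gives `|f h + it|² ≤ ‖h‖² + t²` for all real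
`t`; the `t²` cancels and leaves a bounded linear function of `t`, so `f h` is real. Since `0 ≤ h ≤
‖h‖`, also `‖(‖h‖ - h)‖ ≤ ‖h‖`, whence `‖h‖ - f h ≤ ‖h‖`. -/
theorem apply_star_mul_self_nonneg_of_map_one {A : Type*} [CStarAlgebra A] {f : A →L[ℂ] ℂ}
    (hf : ‖f‖ ≤ 1) (h1 : f 1 = 1) (a : A) : 0 ≤ f (star a * a) := by
  let _ := CStarAlgebra.spectralOrder A
  have _ := CStarAlgebra.spectralOrderedRing A
  have bound : ∀ x, ‖f x‖ ≤ ‖x‖ := fun x => by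
    simpa using f.le_of_opNorm_le hf x
  set h := star a * a with hh
  have h0 : 0 ≤ h := star_mul_self_nonneg a
  have hs : star h = h := (IsSelfAdjoint.of_nonneg h0).star_eq
  have him : (f h).im = 0 := by
    have key : ∀ t : ℝ, 2 * ((f h).im * t) ≤ ‖h‖ ^ 2 := by
      intro t
      have e1 : f (h + (t * Complex.I) • (1 : A)) = f h + t * Complex.I := by
        rw [map_add, map_smul, h1, smul_eq_mul, mul_one]
      have e2 : star (h + (t * Complex.I) • (1 : A)) * (h + (t * Complex.I) • (1 : A)) =
          h * h + ((t : ℂ) ^ 2) • (1 : A) := by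
        have hc : star ((t : ℂ) * Complex.I) = -(t * Complex.I) := by simp
        have hI : ((t : ℂ) * Complex.I) * (t * Complex.I) = -(t : ℂ) ^ 2 := by
          linear_combination (t : ℂ) ^ 2 * Complex.I_mul_I
        rw [star_add, star_smul, star_one, hs, hc]
        simp only [add_mul, mul_add, smul_mul_assoc, mul_smul_comm, one_mul, mul_one, neg_smul,
          neg_mul]
        rw [smul_add, smul_neg, smul_smul, hI, neg_smul]
        abel
      have n1 : ‖f h + t * Complex.I‖ ^ 2 ≤ ‖h‖ ^ 2 + t ^ 2 := by
        rw [← e1]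
        calc _ ≤ ‖h + (t * Complex.I) • (1 : A)‖ ^ 2 :=
              pow_le_pow_left₀ (norm_nonneg _) (bound _) 2
          _ = ‖h * h + ((t : ℂ) ^ 2) • (1 : A)‖ := by
              rw [← e2, CStarRing.norm_star_mul_self, pow_two]
          _ ≤ ‖h * h‖ + ‖((t : ℂ) ^ 2) • (1 : A)‖ := norm_add_le _ _
          _ ≤ ‖h‖ ^ 2 + t ^ 2 := by
              refine add_le_add (by rw [pow_two]; exact norm_mul_le _ _) ?_
              rw [norm_smul]
              have : ‖(1 : A)‖ ≤ 1 := by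
                rcases subsingleton_or_nontrivial A with _ | _
                · rw [Subsingleton.elim (1 : A) 0, norm_zero]; exact zero_le_one
                · exact CStarRing.norm_one.le
              simpa using mul_le_mul_of_nonneg_left this (sq_nonneg t)
      rw [Complex.sq_norm, Complex.normSq_apply] at n1
      simp at n1
      nlinarith [sq_nonneg (f h).re, sq_nonneg (f h).im]
    by_contra hne
    -- This `t` turns the bound into `2 (‖h‖² + 1) ≤ ‖h‖²`.
    have := key ((‖h‖ ^ 2 + 1) / (f h).im)
    rw [mul_div_cancel₀ _ hne] at this
    nlinarith [sq_nonneg ‖h‖]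
  have hre : 0 ≤ (f h).re := by
    have hle : h ≤ algebraMap ℝ A ‖h‖ := IsSelfAdjoint.le_algebraMap_norm_self hs
    have hn : ‖algebraMap ℝ A ‖h‖ - h‖ ≤ ‖h‖ :=
      (CStarAlgebra.norm_le_iff_le_algebraMap _ (norm_nonneg h) (sub_nonneg.2 hle)).2
        (sub_le_self _ h0)
    have e : f (algebraMap ℝ A ‖h‖ - h) = ‖h‖ - f h := by
      have : algebraMap ℝ A ‖h‖ = (‖h‖ : ℂ) • (1 : A) := by
        rw [Algebra.algebraMap_eq_smul_one]; simp
      rw [map_sub, this, map_smul, h1, smul_eq_mul, mul_one]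
    have := (Complex.re_le_norm _).trans ((bound _).trans hn)
    rw [e] at this
    simpa using this
  exact Complex.nonneg_iff.2 ⟨hre, him.symm⟩

/-- The norm of a positive element lies in its spectrum, and adding 1 translates the spectrum. -/
theorem norm_one_add_of_nonneg {A : Type*} [CStarAlgebra A] [PartialOrder A] [StarOrderedRing A]
    [Nontrivial A] {a : A} (ha : 0 ≤ a) : ‖1 + a‖ = 1 + ‖a‖ := by
  refine le_antisymm ((norm_add_le _ _).trans (by rw [CStarRing.norm_one])) ?_
  have h1 : ‖a‖ ∈ spectrum ℝ a := CStarAlgebra.norm_mem_spectrum_of_nonneg ha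
  have h2 : 1 + ‖a‖ ∈ spectrum ℝ (1 + a) := by
    rw [add_comm 1 ‖a‖]; simpa using spectrum.add_mem_add_iff (s := 1) |>.2 h1
  have := spectrum.norm_le_norm_of_mem h2
  rwa [Real.norm_of_nonneg (by positivity)] at this

/-- Every nonzero `y` has a norming state. -/
theorem exists_state_apply_star_mul_self {C : Type*} [NonUnitalCStarAlgebra C] {y : C}
    (hy : y ≠ 0) : ∃ φ ∈ stateSpace C, φ (star y * y) = (‖y‖ ^ 2 : ℝ) := by
  let _ := CStarAlgebra.spectralOrder (Unitization ℂ C)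
  have _ := CStarAlgebra.spectralOrderedRing (Unitization ℂ C)
  set a : Unitization ℂ C := star (y : Unitization ℂ C) * y with ha
  have hna : ‖a‖ = ‖y‖ ^ 2 := by
    rw [ha, CStarRing.norm_star_mul_self, Unitization.norm_inr, pow_two]
  -- Norming `1 + a` instead of `a` controls two values at once: since `‖1 + a‖ = 1 + ‖a‖`, equality
  -- is forced both in `|g 1| ≤ 1` and in `|g a| ≤ ‖a‖`. The first makes `g` positive, the second
  -- makes it norming.
  obtain ⟨g, hg, hga⟩ := exists_dual_vector'' ℂ (1 + a)
  have bound : ∀ x, ‖g x‖ ≤ ‖x‖ := fun x => by simpa using g.le_of_opNorm_le hg x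
  rw [norm_one_add_of_nonneg (star_mul_self_nonneg _), map_add] at hga
  have b1 : ‖g 1‖ ≤ 1 := (bound 1).trans CStarRing.norm_one.le
  have b2 : ‖g a‖ ≤ ‖a‖ := bound a
  have hre : (g 1).re + (g a).re = 1 + ‖a‖ := by simpa using congrArg Complex.re hga
  have r1 : (g 1).re = ‖g 1‖ := by
    linarith [Complex.re_le_norm (g 1), Complex.re_le_norm (g a)]
  have r2 : (g a).re = ‖g a‖ := by
    linarith [Complex.re_le_norm (g 1), Complex.re_le_norm (g a)]
  have g1 : g 1 = 1 := by
    rw [Complex.eq_coe_norm_of_nonneg (Complex.re_eq_norm.1 r1)]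
    exact_mod_cast (by linarith : ‖g 1‖ = 1)
  have g2 : g a = (‖a‖ : ℂ) := by
    rw [Complex.eq_coe_norm_of_nonneg (Complex.re_eq_norm.1 r2)]
    exact_mod_cast (by linarith : ‖g a‖ = ‖a‖)
  have hφ : ∀ x : C, ‖(g.toLinearMap ∘ₗ
      (Unitization.inrNonUnitalAlgHom ℂ C : C →ₗ[ℂ] Unitization ℂ C)) x‖ ≤ 1 * ‖x‖ := fun x => by
    rw [one_mul, ← Unitization.norm_inr (𝕜 := ℂ) x]; exact bound _
  set φ : C →L[ℂ] ℂ := LinearMap.mkContinuous _ 1 hφ with hφd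
  have φa : ∀ x : C, φ x = g (x : Unitization ℂ C) := fun x => rfl
  have φy : φ (star y * y) = (‖y‖ ^ 2 : ℝ) := by
    rw [φa, Unitization.inr_mul, Unitization.inr_star, ← hna]; exact g2
  refine ⟨φ, ⟨fun x => ?_, le_antisymm (LinearMap.mkContinuous_norm_le _ zero_le_one _) ?_⟩, φy⟩
  · rw [φa, Unitization.inr_mul, Unitization.inr_star]
    exact apply_star_mul_self_nonneg_of_map_one hg g1 _
  -- Restriction from the unitization to `C` loses no norm: `φ` attains the value `‖y‖²` at `star y
  -- * y`, whose norm is `‖y‖²`.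
  · have := φ.le_opNorm (star y * y)
    rw [φy, Complex.norm_of_nonneg (by positivity), CStarRing.norm_star_mul_self, ← pow_two] at this
    exact le_of_mul_le_mul_right (by simpa using this) (pow_pos (norm_pos_iff.2 hy) 2)

theorem exists_state_map_one (D : Type*) [CStarAlgebra D] [Nontrivial D] :
    ∃ ψ ∈ stateSpace D, ψ 1 = 1 := by
  obtain ⟨ψ, hψ, h⟩ := exists_state_apply_star_mul_self (one_ne_zero (α := D))
  exact ⟨ψ, hψ, by simpa using h⟩

end States

/-! ### Contractivity of the slice map -/

section Slice

variable {C : Type*} {D : Type*} [NonUnitalCStarAlgebra C] [CStarAlgebra D]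

/-- The right slice map `c ⊗ d ↦ ψ d • c` on the algebraic tensor product. -/
noncomputable def sliceMap (ψ : D →L[ℂ] ℂ) : C ⊗[ℂ] D →ₗ[ℂ] C :=
  (TensorProduct.rid ℂ C).toLinearMap ∘ₗ TensorProduct.map LinearMap.id ψ.toLinearMap

@[simp]
theorem sliceMap_tmul (ψ : D →L[ℂ] ℂ) (c : C) (d : D) : sliceMap ψ (c ⊗ₜ d) = ψ d • c := by
  simp [sliceMap]

/-- Factors `u ⊗ 1` and `v ⊗ 1` act on the first leg only, so `ψ` can be applied to the second leg
beforehand. This ties the slice to quantities that the minimal norm bounds. -/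
theorem tensorFunctional_star_mul_mul (φ : C →L[ℂ] ℂ) (ψ : D →L[ℂ] ℂ) (u v : C) (z : C ⊗[ℂ] D) :
    tensorFunctional φ ψ (star (v ⊗ₜ[ℂ] (1 : D)) * (z * (u ⊗ₜ 1))) =
      φ (star v * (sliceMap ψ z * u)) := by
  induction z with
  | zero => simp
  | add x y hx hy => simp only [add_mul, mul_add, map_add, hx, hy]
  | tmul c d =>
    simp only [TensorProduct.star_tmul, Algebra.TensorProduct.tmul_mul_tmul, star_one, one_mul,
      mul_one, sliceMap_tmul, smul_mul_assoc, mul_smul_comm, map_smul, smul_eq_mul]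
    simp [tensorFunctional, mul_comm]

theorem norm_apply_le_of_mem_stateSpace {φ : C →L[ℂ] ℂ} (hφ : φ ∈ stateSpace C) (c : C) :
    ‖φ c‖ ≤ ‖c‖ := by
  simpa using φ.le_of_opNorm_le hφ.2.le c

theorem stateNorm_tmul_one_le {φ : C →L[ℂ] ℂ} {ψ : D →L[ℂ] ℂ} (hφ : φ ∈ stateSpace C)
    (hψ1 : ψ 1 = 1) (u : C) : stateNorm φ ψ (u ⊗ₜ 1) ≤ ‖u‖ := by
  refine Real.sqrt_le_iff.2 ⟨norm_nonneg u, (Complex.re_le_norm _).trans ?_⟩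
  have : tensorFunctional φ ψ (star (u ⊗ₜ[ℂ] (1 : D)) * (u ⊗ₜ 1)) = φ (star u * u) := by
    simp [tensorFunctional, hψ1]
  rw [this, pow_two, ← CStarRing.norm_star_mul_self]
  exact norm_apply_le_of_mem_stateSpace hφ _

/-- With a unit in `C` one would test `z` against `1 ⊗ 1`; here `h = star x * x` replaces the unit.
If `φ` norms `y = x * h`, then `‖y‖² = φ (star y * (x * h))` is the coefficient of `z` between `y ⊗
1` and `h ⊗ 1`, so Cauchy–Schwarz bounds it by `‖y‖ * minNorm z * ‖h‖`. As `‖y‖ = ‖x‖³` and `‖h‖ =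
‖x‖²`, cancelling gives the claim. -/
theorem norm_sliceMap_le {ψ : D →L[ℂ] ℂ} (hψ : ψ ∈ stateSpace D) (hψ1 : ψ 1 = 1)
    (z : C ⊗[ℂ] D) : ‖sliceMap ψ z‖ ≤ minNorm z := by
  set x := sliceMap ψ z with hx
  set h := star x * x with hh
  set y := x * h with hy
  rcases eq_or_ne x 0 with h0 | h0
  · rw [h0, norm_zero]; exact minNorm_nonneg z
  have hxpos : 0 < ‖x‖ := norm_pos_iff.2 h0
  have nh : ‖h‖ = ‖x‖ ^ 2 := by rw [hh, CStarRing.norm_star_mul_self, pow_two]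
  have ny : ‖y‖ = ‖x‖ ^ 3 := by
    have hs : star h = h := by simp [hh]
    have h2 : ‖h * h‖ = ‖x‖ ^ 4 := by
      calc ‖h * h‖ = ‖star h * h‖ := by rw [hs]
        _ = ‖x‖ ^ 4 := by rw [CStarRing.norm_star_mul_self, nh]; ring
    refine le_antisymm ((norm_mul_le _ _).trans_eq (by rw [nh]; ring)) ?_
    -- The lower bound for `‖y‖` comes from `star x * y = h * h`, of norm `‖x‖⁴` by the C⋆-identity.
    have h3 : ‖x‖ * ‖x‖ ^ 3 ≤ ‖x‖ * ‖y‖ := by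
      calc ‖x‖ * ‖x‖ ^ 3 = ‖star x * y‖ := by rw [hy, ← mul_assoc, ← hh, h2]; ring
        _ ≤ ‖x‖ * ‖y‖ := (norm_mul_le _ _).trans_eq (by rw [norm_star])
    exact le_of_mul_le_mul_left h3 hxpos
  have hypos : 0 < ‖y‖ := by rw [ny]; positivity
  obtain ⟨φ, hφ, hφy⟩ := exists_state_apply_star_mul_self (norm_pos_iff.1 hypos)
  have e := tensorFunctional_star_mul_mul φ ψ h y z
  rw [← hx, ← hy, hφy] at e
  have b := norm_tensorFunctional_le hφ hψ (y ⊗ₜ 1) (z * (h ⊗ₜ 1))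
  rw [e, Complex.norm_of_nonneg (by positivity)] at b
  have b' : ‖y‖ ^ 2 ≤ ‖y‖ * (minNorm z * ‖h‖) :=
    b.trans <| mul_le_mul (stateNorm_tmul_one_le hφ hψ1 y)
      ((stateNorm_mul_le hφ hψ _ _).trans <|
        mul_le_mul_of_nonneg_left (stateNorm_tmul_one_le hφ hψ1 h) (minNorm_nonneg z))
      (stateNorm_nonneg _ _ _) (norm_nonneg y)
  rw [pow_two] at b'
  have b'' := le_of_mul_le_mul_left b' hypos
  rw [ny, nh, pow_succ'] at b''
  exact le_of_mul_le_mul_right b'' (by positivity)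

theorem minNorm_tmul_le (c : C) (d : D) : minNorm (c ⊗ₜ[ℂ] d) ≤ ‖c‖ * ‖d‖ := by
  refine minNorm_le (by positivity) fun φ hφ ψ hψ w => ?_
  obtain ⟨E, _, _, V, hV, hb⟩ := exists_gns hφ hψ
  rw [stateNorm_eq V hV, stateNorm_eq V hV]
  exact hb c d w

/-! ### Slice map and amplification on the completion -/

variable (C) in
/-- The contractive extension of the right slice map to the minimal tensor product. -/
noncomputable def minSlice (ψ : D →L[ℂ] ℂ) : MinTensor C D →L[ℂ] C :=
  LinearMap.extendOfNorm (E := AlgTensor C D) (sliceMap (C := C) ψ)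
    (MinTensor.ofAlg C D).toLinearMap

theorem norm_minSlice_le {ψ : D →L[ℂ] ℂ} (hψ : ψ ∈ stateSpace D) (hψ1 : ψ 1 = 1)
    (x : MinTensor C D) : ‖minSlice C ψ x‖ ≤ ‖x‖ := by
  refine (LinearMap.norm_extendOfNorm_apply_le (MinTensor.denseRange_ofAlg C D) 1 (fun z => ?_)
    x).trans_eq (one_mul _)
  rw [one_mul, LinearIsometry.coe_toLinearMap, LinearIsometry.norm_map]
  exact norm_sliceMap_le hψ hψ1 z

theorem minSlice_ofAlg {ψ : D →L[ℂ] ℂ} (hψ : ψ ∈ stateSpace D) (hψ1 : ψ 1 = 1)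
    (z : AlgTensor C D) : minSlice C ψ (MinTensor.ofAlg C D z) = sliceMap ψ z := by
  refine LinearMap.extendOfNorm_eq (MinTensor.denseRange_ofAlg C D) ⟨1, fun z => ?_⟩ z
  rw [one_mul, LinearIsometry.coe_toLinearMap, LinearIsometry.norm_map]
  exact norm_sliceMap_le hψ hψ1 z

variable (C D) in
/-- The amplification `c ↦ c ⊗ 1` into the minimal tensor product. -/
noncomputable def minAmpl : C →ₗ[ℂ] MinTensor C D :=
  (MinTensor.ofAlg C D).toLinearMap ∘ₗ
    ((TensorProduct.mk ℂ C D).flip 1 : C →ₗ[ℂ] AlgTensor C D)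

theorem minAmpl_apply (c : C) : minAmpl C D c = MinTensor.ofAlg C D (AlgTensor.tmul c 1) := rfl

theorem norm_minAmpl_le [Nontrivial D] (c : C) : ‖minAmpl C D c‖ ≤ ‖c‖ := by
  rw [minAmpl_apply, LinearIsometry.norm_map]
  exact (minNorm_tmul_le c (1 : D)).trans_eq (by rw [CStarRing.norm_one, mul_one])

theorem minSlice_minAmpl {ψ : D →L[ℂ] ℂ} (hψ : ψ ∈ stateSpace D) (hψ1 : ψ 1 = 1) (c : C) :
    minSlice C ψ (minAmpl C D c) = c := by
  rw [minAmpl_apply, minSlice_ofAlg hψ hψ1]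
  exact (sliceMap_tmul ψ c 1).trans (by rw [hψ1, one_smul])

theorem minAmpl_mem_minTensorSub {A : NonUnitalStarSubalgebra ℂ C} {a : C} (ha : a ∈ A) :
    minAmpl C D a ∈ minTensorSub D A :=
  subset_closure ⟨AlgTensor.tmul a 1, Submodule.subset_span ⟨a, ha, 1, rfl⟩, rfl⟩

theorem sliceMap_mem (ψ : D →L[ℂ] ℂ) {A : NonUnitalStarSubalgebra ℂ C} {z : AlgTensor C D}
    (hz : z ∈ algTensorSpan D A) : sliceMap ψ z ∈ A := by
  have : algTensorSpan D A ≤ A.toNonUnitalSubalgebra.toSubmodule.comap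
      (sliceMap ψ : AlgTensor C D →ₗ[ℂ] C) := by
    refine Submodule.span_le.2 ?_
    rintro _ ⟨a, ha, d, rfl⟩
    have : sliceMap ψ (a ⊗ₜ[ℂ] d) ∈ A := by
      rw [sliceMap_tmul]; exact SMulMemClass.smul_mem _ ha
    exact this
  exact this hz

/-- Elementary tensors `a ⊗ d` are sliced to multiples of `a`, so the algebraic part lands in `A`;
continuity extends this to the norm closure because `A` is closed. -/
theorem minSlice_mem {ψ : D →L[ℂ] ℂ} (hψ : ψ ∈ stateSpace D) (hψ1 : ψ 1 = 1)
    {A : NonUnitalStarSubalgebra ℂ C} (hA : IsClosed (A : Set C)) {x : MinTensor C D}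
    (hx : x ∈ minTensorSub D A) : minSlice C ψ x ∈ A := by
  refine closure_minimal ?_ (hA.preimage (minSlice C ψ).continuous) hx
  rintro _ ⟨z, hz, rfl⟩
  have : minSlice C ψ (MinTensor.ofAlg C D z) ∈ A := by
    rw [minSlice_ofAlg hψ hψ1]; exact sliceMap_mem ψ hz
  exact this

end Slice

/-! ### The two distance inequalities -/

theorem corollary4p2 {C : Type*} {D : Type*} [NonUnitalCStarAlgebra C] [CStarAlgebra D]
    [Nontrivial D] (A B : NonUnitalStarSubalgebra ℂ C)
    (hA : IsClosed (A : Set C)) (hB : IsClosed (B : Set C)) :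
    dKK A.toNonUnitalSubalgebra.toSubmodule B.toNonUnitalSubalgebra.toSubmodule ≤
        dKK (minTensorSub D A).toNonUnitalSubalgebra.toSubmodule
          (minTensorSub D B).toNonUnitalSubalgebra.toSubmodule ∧
      d0 A.toNonUnitalSubalgebra.toSubmodule B.toNonUnitalSubalgebra.toSubmodule ≤
        d0 (minTensorSub D A).toNonUnitalSubalgebra.toSubmodule
          (minTensorSub D B).toNonUnitalSubalgebra.toSubmodule := by
  obtain ⟨ψ, hψ, hψ1⟩ := exists_state_map_one D
  have hr : ∀ y, ‖(minSlice C ψ).toLinearMap y‖ ≤ ‖y‖ := norm_minSlice_le hψ hψ1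
  have hri : ∀ c, (minSlice C ψ).toLinearMap (minAmpl C D c) = c := minSlice_minAmpl hψ hψ1
  exact ⟨dKK_le_of_retract norm_minAmpl_le hr hri (fun _ => minAmpl_mem_minTensorSub)
      (fun _ => minAmpl_mem_minTensorSub) (fun _ => minSlice_mem hψ hψ1 hA)
      (fun _ => minSlice_mem hψ hψ1 hB),
    d0_le_of_retract norm_minAmpl_le hr hri (fun _ => minAmpl_mem_minTensorSub)
      (fun _ => minAmpl_mem_minTensorSub) (fun _ => minSlice_mem hψ hψ1 hA)
      (fun _ => minSlice_mem hψ hψ1 hB)⟩
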